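/- **Proposition 3.1 (Expressiveness of LLM-Policies).** *Setting.* The state space of a radio access network (RAN) with $K$ users, $N_R$ receive and $N_T$ transmit antennas, $F$ flows, $M$ cells and $L$ carriers is $$\mathcal S=(\mathbb C^{N_R\times N_T})^K\times\mathbb R_{\ge 0}^{K\times F}\times(\mathbb R^M\times\{0,1\}^L)\times\mathbb R^K$$ (channel matrices; queue lengths; transmit powers and carrier activity; SINR values). The intent space $\mathcal I$ is the discrete set of all finite texts over a finite alphabet. Let $\mathcal L$ be a finite set of words ("commands") over a finite alphabet, $V:\mathcal L\to\{0,1\}$ a validator, $\mathcal A=\{c\in\mathcal L: V(c)=1\}$ the discrete action space, $a_0\in\mathcal A$ a fallback action, and $f_{\rm env}:\mathcal S\times\mathcal A\to\mathcal S$ any function (the network dynamics). A *bounded control task* is a set $D\subseteq\mathcal I\times\mathcal S$ on which the intents have bounded length and all numerical state entries are bounded. *Prompt.* For $p\in\mathbb N$ the prompt $\pi_p(i,s)$ is the finite token sequence consisting of the state, with tags around its parts, matrices flattened, bits as bit tokens, and every real number $x$ (real and imaginary parts separately) written digit by digit as a sign, $p$ integer digits, a point and $p$ fractional digits ($|x|$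 rounded down and capped at the largest such numeral), followed by the tagged intent text. The token vocabulary is finite and does not depend on $p$. In a context window of length $n$ the prompt is cut off or padded on the right to length $n$. *Transformer.* A transformer with capacity $C=(d,h,m,r,\ell)$ and context length $n$ maps $n$ input tokens to a matrix $X\in\mathbb R^{d\times n}$ whose columns are token embedding plus position embedding, applies $\ell$ blocks, each of the form $$Y=X+\sum_{k=1}^{h}W_O^kW_V^kX\,\sigma\big[(W_K^kX)^{\top}W_Q^kX\big],\qquad Z=Y+W_2\,\mathrm{ReLU}(W_1Y+b_1\mathbf 1^{\top})+b_2\mathbf 1^{\top}$$ with $\sigma$ the column-wise softmax, $W_O^k\in\mathbb R^{d\times m}$, $W_V^k,W_K^k,W_Q^k\in\mathbb R^{m\times d}$, $W_1\in\mathbb R^{r\times d}$, $W_2\in\mathbb R^{d\times r}$, and outputs at each position a token of maximal score under a linear map of the final column. The output tokens are the letters of the command alphabet and an end token. Its *LLM-RAN operator* is $$\mathcal O:\mathcal I\times\mathcal S\to\mathcal A\times\mathcal S,\qquad \mathcal O(i,s)=(a,f_{\rm env}(s,a)),$$ where $a$ is the word emitted on the prompt before the first end token if that word is in $\mathcal A$,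 and $a=a_0$ otherwise. A property $P$ of operators is *attainable with enough prompt context and sufficient capacity* if there is $p_0$ such that for every $p\ge p_0$ there is $n_0$ such that for every $n\ge n_0$ there is a capacity $C_0$ such that for every capacity $C\ge C_0$ (componentwise) there is a transformer with capacity $C$ and context length $n$ whose operator, with prompts of precision $p$, has property $P$. For $f:\mathcal I\times\mathcal S\to\mathcal A$ write $\hat f(i,s)=(f(i,s),f_{\rm env}(s,f(i,s)))$. *Claim.* For every bounded control task $D$: 1. If $f:\mathcal I\times\mathcal S\to\mathcal A$ and, for some $q\in\mathbb N$, $f(x)=f(y)$ for all $x,y\in D$ with $\pi_q(x)=\pi_q(y)$, then "$\mathcal O=\hat f$ on $D$" is attainable. 2. If $D$ is closed and $f:\mathcal I\times\mathcal S\to\mathcal A$ is continuous on $D$, then "$\mathcal O=\hat f$ on $D$" is attainable. 3. If $f:\mathcal I\times\mathcal S\to\mathcal A$ is measurable, $\mu$ is a finite measure on $\mathcal I\times\mathcal S$ and $\varepsilon>0$, then "$\mu(\{x\in D:\mathcal O(x)\ne\hat f(x)\})\le\varepsilon$" is attainable (for a non-measurable set, $\mu$ denotes outer measure). 4. If $D$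 is closed, $X$ is a pseudometric space, $e:\mathcal A\to X$ is any map (the effect of an action), $g:\mathcal I\times\mathcal S\to X$ is continuous on $D$ and $\varepsilon>0$, then "for all $x\in D$ the action $a$ of $\mathcal O(x)$ satisfies $\mathrm{dist}(e(a),g(x))\le\min_{a'\in\mathcal A}\mathrm{dist}(e(a'),g(x))+\varepsilon$" is attainable. -/

import Mathlib

open scoped NNReal ENNReal

noncomputable section

namespace LLMRAN

/-! ## Radio access network: states, intents, commands -/

/-- The sizes of a radio access network. -/
structure Dims where
  users : ℕ
  rx : ℕ
  tx : ℕ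
  flows : ℕ
  cells : ℕ
  carriers : ℕ

/-- The state space: channel matrices of all users, queue lengths per user and flow,
configuration (transmit powers of the cells, activity bits of the component carriers), and the
SINR of each user. -/
abbrev State (N : Dims) : Type :=
  (Fin N.users → Fin N.rx → Fin N.tx → ℂ) ×
  (Fin N.users → Fin N.flows → ℝ≥0) ×
  ((Fin N.cells → ℝ) × (Fin N.carriers → Bool)) ×
  (Fin N.users → ℝ)

/-- All numerical entries of the state are at most `R` in absolute value. -/
def State.BoundedBy {N : Dims} (R : ℝ) (s : State N) : Prop :=
  (∀ k a b, ‖s.1 k a b‖ ≤ R) ∧ (∀ k f, (s.2.1 k f : ℝ) ≤ R) ∧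
  (∀ c, |s.2.2.1.1 c| ≤ R) ∧ (∀ k, |s.2.2.2 k| ≤ R)

/-- An intent: a text (natural language or formal) over the alphabet `α`. -/
structure Intent (α : Type*) where
  text : List α

/-- Intents form a discrete space. -/
instance (α : Type*) : TopologicalSpace (Intent α) := ⊥
instance (α : Type*) : DiscreteTopology (Intent α) := ⟨rfl⟩
instance (α : Type*) : MeasurableSpace (Intent α) := ⊤

/-- The action space: the commands of the finite command language `Lg` (words over the command
alphabet `β`) that the validator `V` admits. -/
def Action {β : Type*} (Lg : Finset (List β)) (V : Lg → Bool) : Type _ :=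
  {c : Lg // V c = true}

/-- Actions form a discrete space. -/
instance {β : Type*} (Lg : Finset (List β)) (V : Lg → Bool) :
    TopologicalSpace (Action Lg V) := ⊥
instance {β : Type*} (Lg : Finset (List β)) (V : Lg → Bool) :
    DiscreteTopology (Action Lg V) := ⟨rfl⟩
instance {β : Type*} (Lg : Finset (List β)) (V : Lg → Bool) :
    MeasurableSpace (Action Lg V) := ⊤

/-- A set of intent-state pairs is a bounded control task if the intents have bounded length and
the numerical state entries are bounded. -/
def IsBoundedTask {α : Type*} {N : Dims} (D : Set (Intent α × State N)) : Prop :=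
  ∃ (l : ℕ) (R : ℝ), ∀ x ∈ D, x.1.text.length ≤ l ∧ State.BoundedBy R x.2

/-! ## Tokenization of the prompt -/

/-- The tags that delimit the parts of a prompt. -/
inductive Tag where
  | state
  | csi
  | queues
  | config
  | sinr
  | intent

/-- The prompt vocabulary. It does not depend on the precision of the numerals. -/
inductive Token (α : Type*) where
  | opening (t : Tag)
  | closing (t : Tag)
  | plus
  | minus
  | point
  | digit (k : Fin 10)
  | bit (b : Bool)
  | symbol (a : α)
  | pad

/-- The decimal digit of `k` at the place of `10 ^ j`. -/
def digitAt (α : Type*) (k j : ℕ) : Token α :=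
  .digit ⟨k / 10 ^ j % 10, Nat.mod_lt _ (by norm_num)⟩

/-- The real number `x` written as a signed decimal numeral with `p` integer and `p` fractional
digits: `|x|` is rounded down to a multiple of `10 ^ (-p)` and capped at the largest number that
can be written. -/
def numeral (α : Type*) (p : ℕ) (x : ℝ) : List (Token α) :=
  let k : ℕ := min ⌊|x| * 10 ^ p⌋₊ (10 ^ (2 * p) - 1)
  (if x < 0 then Token.minus else Token.plus) ::
    ((List.range p).map (fun j => digitAt α k (2 * p - 1 - j)) ++
      Token.point :: (List.range p).map (fun j => digitAt α k (p - 1 - j)))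

/-- A tagged part of a prompt. -/
def tagged {α : Type*} (t : Tag) (l : List (Token α)) : List (Token α) :=
  Token.opening t :: (l ++ [Token.closing t])

/-- The state written as a token sequence: matrices are flattened row by row, real numbers are
written with precision `p`. -/
def stateTokens (α : Type*) {N : Dims} (p : ℕ) (s : State N) : List (Token α) :=
  tagged .state
    (tagged .csi
      ((List.finRange N.users).flatMap fun k =>
        (List.finRange N.rx).flatMap fun a =>
          (List.finRange N.tx).flatMap fun b =>
            numeral α p (s.1 k a b).re ++ numeral α p (s.1 k a b).im) ++
    tagged .queues
      ((List.finRange N.users).flatMap fun k =>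
        (List.finRange N.flows).flatMap fun f => numeral α p (s.2.1 k f : ℝ)) ++
    tagged .config
      (((List.finRange N.cells).flatMap fun c => numeral α p (s.2.2.1.1 c)) ++
        (List.finRange N.carriers).map fun c => Token.bit (s.2.2.1.2 c)) ++
    tagged .sinr
      ((List.finRange N.users).flatMap fun k => numeral α p (s.2.2.2 k)))

/-- The prompt: the state context followed by the intent. -/
def prompt {α : Type*} {N : Dims} (p : ℕ) (x : Intent α × State N) : List (Token α) :=
  stateTokens α p x.2 ++ tagged .intent (x.1.text.map Token.symbol)

/-- The prompt in a context window of length `n`: cut off, or padded on the right. -/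
def context {α : Type*} {N : Dims} (p n : ℕ) (x : Intent α × State N) (j : Fin n) : Token α :=
  (prompt p x).getD j Token.pad

/-! ## Transformers -/

/-- The capacity of a transformer: embedding dimension, number of attention heads, size of a
head, number of hidden units of the feed-forward layers, number of blocks. -/
structure Capacity where
  width : ℕ
  heads : ℕ
  headSize : ℕ
  hidden : ℕ
  depth : ℕ

/-- Capacities are compared component by component. -/
instance : LE Capacity :=
  ⟨fun C C' => C.width ≤ C'.width ∧ C.heads ≤ C'.heads ∧ C.headSize ≤ C'.headSize ∧
    C.hidden ≤ C'.hidden ∧ C.depth ≤ C'.depth⟩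

/-- The softmax of each column of a matrix. -/
def softmaxCols {n : ℕ} (A : Matrix (Fin n) (Fin n) ℝ) : Matrix (Fin n) (Fin n) ℝ :=
  fun k j => Real.exp (A k j) / ∑ l, Real.exp (A l j)

/-- The parameters of a transformer block. -/
structure Block (C : Capacity) where
  WO : Fin C.heads → Matrix (Fin C.width) (Fin C.headSize) ℝ
  WV : Fin C.heads → Matrix (Fin C.headSize) (Fin C.width) ℝ
  WK : Fin C.heads → Matrix (Fin C.headSize) (Fin C.width) ℝ
  WQ : Fin C.heads → Matrix (Fin C.headSize) (Fin C.width) ℝ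
  W₁ : Matrix (Fin C.hidden) (Fin C.width) ℝ
  b₁ : Fin C.hidden → ℝ
  W₂ : Matrix (Fin C.width) (Fin C.hidden) ℝ
  b₂ : Fin C.width → ℝ

/-- Multi-head softmax self-attention with a residual connection; the columns of `X` are the
positions of the sequence. -/
def Block.attention {C : Capacity} (B : Block C) {n : ℕ} (X : Matrix (Fin C.width) (Fin n) ℝ) :
    Matrix (Fin C.width) (Fin n) ℝ :=
  X + ∑ h, B.WO h * (B.WV h * X) * softmaxCols ((B.WK h * X).transpose * (B.WQ h * X))

/-- The position-wise ReLU feed-forward layer with a residual connection. -/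
def Block.feedForward {C : Capacity} (B : Block C) {n : ℕ}
    (X : Matrix (Fin C.width) (Fin n) ℝ) : Matrix (Fin C.width) (Fin n) ℝ :=
  X + B.W₂ * (Matrix.of fun u j => max ((B.W₁ * X) u j + B.b₁ u) 0) +
    Matrix.of fun i _ => B.b₂ i

/-- A transformer block. -/
def Block.apply {C : Capacity} (B : Block C) {n : ℕ} (X : Matrix (Fin C.width) (Fin n) ℝ) :
    Matrix (Fin C.width) (Fin n) ℝ :=
  B.feedForward (B.attention X)

/-- The parameters of a transformer with capacity `C`, context length `n`, input vocabulary `υ`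
and output vocabulary `ω`. -/
structure Transformer (C : Capacity) (n : ℕ) (υ ω : Type*) where
  embedding : υ → Fin C.width → ℝ
  position : Fin n → Fin C.width → ℝ
  blocks : Fin C.depth → Block C
  unembedding : ω → Fin C.width → ℝ

/-- The hidden representation of the input sequence after all blocks. -/
def Transformer.forward {C : Capacity} {n : ℕ} {υ ω : Type*} (T : Transformer C n υ ω)
    (x : Fin n → υ) : Matrix (Fin C.width) (Fin n) ℝ :=
  (List.ofFn T.blocks).foldl (fun X B => B.apply X)
    (Matrix.of fun i j => T.embedding (x j) i + T.position j i)

/-- The score of the output token `w` at position `j`. -/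
def Transformer.logit {C : Capacity} {n : ℕ} {υ ω : Type*} (T : Transformer C n υ ω)
    (x : Fin n → υ) (j : Fin n) (w : ω) : ℝ :=
  ∑ i, T.unembedding w i * T.forward x i j

/-- Greedy decoding: at each position a token with the largest score. -/
def Transformer.output {C : Capacity} {n : ℕ} {υ ω : Type*} [Finite ω] [Nonempty ω]
    (T : Transformer C n υ ω) (x : Fin n → υ) (j : Fin n) : ω :=
  Classical.choose (Finite.exists_max (T.logit x j))

/-! ## The LLM-RAN operator -/

/-- The word in front of the first end token `none`. -/
def decode {β : Type*} {n : ℕ} (y : Fin n → Option β) : List β :=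
  ((List.ofFn y).takeWhile Option.isSome).reduceOption

open Classical in
/-- The safety filter: a word that is a command of the language and passes the validator is
emitted, any other word is replaced by the fallback action. -/
def filterAction {β : Type*} (Lg : Finset (List β)) (V : Lg → Bool) (fallback : Action Lg V)
    (w : List β) : Action Lg V :=
  if h : ∃ hw : w ∈ Lg, V ⟨w, hw⟩ = true then ⟨⟨w, h.1⟩, h.2⟩ else fallback

/-- The action that the transformer `T` takes on an intent and a state. -/
def policy {α β : Type*} [Finite β] {N : Dims} {Lg : Finset (List β)} {V : Lg → Bool}
    (fallback : Action Lg V) (p : ℕ) {n : ℕ} {C : Capacity}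
    (T : Transformer C n (Token α) (Option β)) (x : Intent α × State N) : Action Lg V :=
  filterAction Lg V fallback (decode (T.output (context p n x)))

/-- The LLM-RAN operator of the transformer `T`: it takes an intent and a state to the action
of `T` and the next state under the network dynamics `env`. -/
def operator {α β : Type*} [Finite β] {N : Dims} {Lg : Finset (List β)} {V : Lg → Bool}
    (env : State N → Action Lg V → State N) (fallback : Action Lg V) (p : ℕ) {n : ℕ}
    {C : Capacity} (T : Transformer C n (Token α) (Option β)) (x : Intent α × State N) :
    Action Lg V × State N :=
  (policy fallback p T x, env x.2 (policy fallback p T x))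

/-- With enough prompt context (numerals of every sufficiently high precision `p`, and then every
sufficiently long context window `n`) and every sufficient model capacity `C` there are
transformer parameters whose LLM-RAN operator has the property `P`. -/
def Attainable {α β : Type*} [Finite β] {N : Dims} {Lg : Finset (List β)} {V : Lg → Bool}
    (env : State N → Action Lg V → State N) (fallback : Action Lg V)
    (P : (Intent α × State N → Action Lg V × State N) → Prop) : Prop :=
  ∃ p₀ : ℕ, ∀ p ≥ p₀, ∃ n₀ : ℕ, ∀ n ≥ n₀, ∃ C₀ : Capacity, ∀ C : Capacity, C₀ ≤ C →
    ∃ T : Transformer C n (Token α) (Option β), P (operator env fallback p T)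

end LLMRAN

end

/-!
A transformer of sufficient capacity realizes every function on token sequences of a fixed length
(`exists_transformer_output_eq`), with two blocks. The feed-forward layer of the first block
turns the sum of token and position embedding into an indicator of the pair (position, token);
the second block adds up these indicators over all positions by uniform attention, so that every
column carries the whole sequence, and its feed-forward layer has one hidden unit for each
sequence and position, which is active on exactly that input. Further heads, blocks and
coordinates are set to zero.

A context window that is long enough holds the whole prompt of every point of a bounded task, and
the prompt can be read off from it. So the policies that can be realized on the task are the
functions of the prompt (`attainable_of_prompt_policies`), and the rest concerns what a
prompt reveals. Numerals of high precision determine those of lower precision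
(`prompt_eq_of_le`), and points of a bounded task that have the same prompt of precision `p` for
`p → ∞` have the same limit (`tendsto_of_prompt_eq`). On a closed bounded task, which is compact,
a continuous function therefore varies little among the points with the same prompt of high
precision (`exists_precision`). For an action-valued function this means that it is a function of
the prompt; for a target configuration it means that an action which is best for one
representative of each prompt is nearly best for all points with that prompt. A measurable policy
is continuous on a closed set of nearly full measure (`exists_isClosed_continuousOn`), and the
intersection of that set with a bounded box is again a closed bounded task.
-/

open scoped NNReal ENNReal

namespace LLMRAN

/-! ### Memorization by a two-block transformer -/

/-- The matrix `A` with its rows placed at the indices `f` and its columns at the indices `e` of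
a larger matrix, which is zero elsewhere. -/
noncomputable def paddedMatrix {μ ι M I : Type*} (f : μ → M) (e : ι → I) (A : μ → ι → ℝ) :
    Matrix M I ℝ :=
  Matrix.of fun u i => Function.extend f (fun h => Function.extend e (A h) 0) 0 u i

lemma paddedMatrix_mul_apply {μ ι M I J : Type*} [Fintype ι] [Fintype I] {f : μ → M}
    (hf : f.Injective) {e : ι → I} (he : e.Injective) (A : μ → ι → ℝ) (X : Matrix I J ℝ)
    (h : μ) (j : J) : (paddedMatrix f e A * X) (f h) j = ∑ a, A h a * X (e a) j := by
  rw [Matrix.mul_apply]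
  symm
  refine Fintype.sum_of_injective e he _ _ (fun i hi => ?_) (fun a => ?_)
  · rw [paddedMatrix, Matrix.of_apply, hf.extend_apply, Function.extend_apply' _ _ _ hi]
    simp
  · rw [paddedMatrix, Matrix.of_apply, hf.extend_apply, he.extend_apply]

lemma softmaxCols_zero_apply {n : ℕ} (l j : Fin n) :
    softmaxCols (0 : Matrix (Fin n) (Fin n) ℝ) l j = (n : ℝ)⁻¹ := by
  simp [softmaxCols]

/-- A block whose attention is uniform, so that it can add to each position the sum over all
positions of a linear image of the columns, and whose feed-forward layer is arbitrary. The
coordinates in use are those in the range of `e`; the block ignores the others. -/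
lemma exists_block {ι κ : Type*} [Fintype ι] [Fintype κ] {C : Capacity} (n : ℕ)
    (e : ι ↪ Fin C.width) (m : ι ↪ Fin C.headSize) (u : κ ↪ Fin C.hidden) (hC : 0 < C.heads)
    (A : ι → ι → ℝ) (W₁ : κ → ι → ℝ) (b : κ → ℝ) (W₂ : ι → κ → ℝ) :
    ∃ B : Block C, ∀ (X : Matrix (Fin C.width) (Fin n) ℝ) (Y : Matrix ι (Fin n) ℝ),
      (∀ a j, Y a j = X (e a) j + ∑ l, ∑ c, A a c * X (e c) l) →
      ∀ a j, B.apply X (e a) j =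
        Y a j + ∑ h, W₂ a h * max (∑ c, W₁ h c * Y c j + b h) 0 := by
  classical
  -- The factor `n` undoes the averaging of the uniform softmax.
  let B : Block C :=
    { WO := fun i => if i = ⟨0, hC⟩ then paddedMatrix e m (fun a c => n * A a c) else 0
      WV := fun _ => paddedMatrix m e (fun a c : ι => if a = c then 1 else 0)
      WK := 0
      WQ := 0
      W₁ := paddedMatrix u e W₁
      b₁ := Function.extend u b 0
      W₂ := paddedMatrix e u W₂
      b₂ := 0 }
  refine ⟨B, fun X Y hY a j => ?_⟩
  have hatt : ∀ a j, B.attention X (e a) j = Y a j := by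
    intro a j
    have hn : (n : ℝ) ≠ 0 := by
      have := j.pos
      positivity
    have hV : ∀ c l,
        (paddedMatrix m e (fun a c : ι => if a = c then 1 else 0) * X) (m c) l = X (e c) l := by
      intro c l
      rw [paddedMatrix_mul_apply m.injective e.injective]
      simp
    rw [hY, Block.attention, Matrix.add_apply, Finset.sum_eq_single ⟨0, hC⟩]
    · have h0 : ((B.WK ⟨0, hC⟩ * X).transpose * (B.WQ ⟨0, hC⟩ * X)) = 0 := by
        simp [B]
      rw [h0, Matrix.mul_apply]
      congr 1
      refine Finset.sum_congr rfl fun l _ => ?_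
      rw [softmaxCols_zero_apply]
      simp only [B, if_true]
      rw [paddedMatrix_mul_apply e.injective m.injective, Finset.sum_mul]
      refine Finset.sum_congr rfl fun c _ => ?_
      rw [hV]
      field_simp
    · intro i _ hi
      simp [B, hi]
    · simp
  rw [Block.apply, Block.feedForward, Matrix.add_apply, Matrix.add_apply, hatt]
  simp only [B, Matrix.of_apply, Pi.zero_apply, add_zero]
  rw [paddedMatrix_mul_apply e.injective u.injective]
  congr 1
  refine Finset.sum_congr rfl fun h _ => ?_
  rw [Matrix.of_apply, paddedMatrix_mul_apply u.injective e.injective, u.injective.extend_apply]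
  simp only [B] at hatt
  simp only [hatt]

/-- The block that does nothing; it fills up the depth. -/
lemma exists_identity_block (C : Capacity) (n : ℕ) :
    ∃ B : Block C, ∀ X : Matrix (Fin C.width) (Fin n) ℝ, B.apply X = X :=
  ⟨⟨0, 0, 0, 0, 0, 0, 0, 0⟩, fun X => by
    ext i j
    simp [Block.apply, Block.feedForward, Block.attention]⟩

lemma foldl_eq_self {γ δ : Type*} (g : δ → γ → δ) (l : List γ) (h : ∀ b ∈ l, ∀ X, g X b = X)
    (X : δ) : l.foldl g X = X := by
  induction l generalizing X with
  | nil => rfl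
  | cons b l ih =>
    rw [List.foldl_cons, h b (by simp), ih fun b hb => h b (by simp [hb])]

/-- Two blocks can be run in a transformer of any larger depth. -/
lemma exists_transformer_two_blocks {C : Capacity} {n : ℕ} {υ ω : Type*} (hC : 2 ≤ C.depth)
    (E : υ → Fin C.width → ℝ) (Q : Fin n → Fin C.width → ℝ) (B₁ B₂ : Block C)
    (U : ω → Fin C.width → ℝ) :
    ∃ T : Transformer C n υ ω, T.unembedding = U ∧ ∀ x, T.forward x =
      B₂.apply (B₁.apply (Matrix.of fun i j => E (x j) i + Q j i)) := by
  obtain ⟨B₀, hB₀⟩ := exists_identity_block C n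
  refine ⟨⟨E, Q, fun i => if i.1 = 0 then B₁ else if i.1 = 1 then B₂ else B₀, U⟩, rfl,
    fun x => ?_⟩
  obtain ⟨w, h, m, r, d⟩ := C
  obtain ⟨d, rfl⟩ : ∃ k, d = k + 2 := ⟨d - 2, by simp at hC; omega⟩
  simp only [Transformer.forward, List.ofFn_succ, List.foldl_cons, Fin.val_zero, Fin.val_succ,
    if_true, zero_add, Nat.add_eq_zero_iff, one_ne_zero, and_false, if_false]
  refine foldl_eq_self _ _ (fun B hB X => ?_) _
  obtain ⟨i, rfl⟩ := (List.mem_ofFn' _ _).1 hB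
  simp [hB₀]

lemma exists_embedding_fin {ι : Type*} [Finite ι] {k : ℕ} (h : Nat.card ι ≤ k) :
    Nonempty (ι ↪ Fin k) := by
  have := Fintype.ofFinite ι
  exact Function.Embedding.nonempty_of_card_le (by simpa [Nat.card_eq_fintype_card] using h)

/-- The indicator of a single sequence and position as a rectified sum of matches. There are
`n + 2` terms that can match, and they all do only on the right sequence and position. -/
lemma relu_matches {n : ℕ} {υ : Type*} [DecidableEq υ] (x y : Fin n → υ) (j k : Fin n) :
    max ((∑ l, ((if k = l ∧ x k = y l then (1 : ℝ) else 0) + if x l = y l then 1 else 0)) +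
      (if k = j then 1 else 0) + -(n + 1 : ℝ)) 0 = if y = x ∧ j = k then 1 else 0 := by
  have h1 : (∑ l, if k = l ∧ x k = y l then (1 : ℝ) else 0) = if x k = y k then 1 else 0 := by
    rw [Finset.sum_eq_single k]
    · simp
    · intro b _ hb
      simp [hb.symm]
    · simp
  rw [Finset.sum_add_distrib, h1]
  by_cases hxy : y = x
  · subst hxy
    by_cases hj : j = k
    · subst hj
      simp
    · simp [hj, Ne.symm hj]
      ring_nf
      simp
  · obtain ⟨i, hi⟩ : ∃ i, x i ≠ y i := by
      by_contra! h
      exact hxy (funext fun i => (h i).symm)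
    have h2 : (∑ l, if x l = y l then (1 : ℝ) else 0) + 1 ≤ n := by
      rw [← Finset.sum_erase_add _ _ (Finset.mem_univ i), if_neg hi, add_zero]
      have : (∑ l ∈ Finset.univ.erase i, if x l = y l then (1 : ℝ) else 0) ≤
          ∑ l ∈ Finset.univ.erase i, 1 :=
        Finset.sum_le_sum fun l _ => by split_ifs <;> norm_num
      have h3 : (∑ l ∈ Finset.univ.erase i, (1 : ℝ)) + 1 = n := by
        rw [Finset.sum_erase_add Finset.univ (fun _ => (1 : ℝ)) (Finset.mem_univ i)]
        simp
      linarith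
    have h3 : (if x k = y k then (1 : ℝ) else 0) ≤ 1 := by split_ifs <;> norm_num
    have h4 : (if k = j then (1 : ℝ) else 0) ≤ 1 := by split_ifs <;> norm_num
    rw [if_neg (fun h => hxy h.1 : ¬(y = x ∧ j = k))]
    exact max_eq_right (by linarith)

lemma Transformer.output_eq_of_logit {C : Capacity} {n : ℕ} {υ ω : Type*} [Finite ω]
    [Nonempty ω] (T : Transformer C n υ ω) (x : Fin n → υ) (j : Fin n) (w : ω)
    (h : ∀ v, v ≠ w → T.logit x j v < T.logit x j w) : T.output x j = w := by
  by_contra hne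
  exact absurd (Classical.choose_spec (Finite.exists_max (T.logit x j)) w)
    (not_le.2 (h _ hne))

/-- Every function on token sequences of a fixed length is computed by the transformers of every
sufficiently large capacity. -/
theorem exists_transformer_output_eq {υ ω : Type*} [Finite υ] [Finite ω] [Nonempty ω] (n : ℕ)
    (F : (Fin n → υ) → Fin n → ω) :
    ∃ C₀ : Capacity, ∀ C : Capacity, C₀ ≤ C →
      ∃ T : Transformer C n υ ω, ∀ x, T.output x = F x := by
  classical
  have := Fintype.ofFinite υ
  have := Fintype.ofFinite ω
  -- Coordinates: token, position, pairs of a position and its token, output.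
  let ι := υ ⊕ Fin n ⊕ (Fin n × υ) ⊕ ω
  refine ⟨⟨Nat.card ι, 1, Nat.card ι, Nat.card (Fin n × υ) + Nat.card ((Fin n → υ) × Fin n), 2⟩,
    fun C ⟨hw, hh, hm, hr, hd⟩ => ?_⟩
  obtain ⟨e⟩ := exists_embedding_fin hw
  obtain ⟨m⟩ := exists_embedding_fin hm
  obtain ⟨u₁⟩ : Nonempty (Fin n × υ ↪ Fin C.hidden) :=
    exists_embedding_fin (by simp at hr ⊢; omega)
  obtain ⟨u₂⟩ : Nonempty ((Fin n → υ) × Fin n ↪ Fin C.hidden) :=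
    exists_embedding_fin (by simp at hr ⊢; omega)
  -- The first block marks the pair of the position and its token.
  obtain ⟨B₁, hB₁⟩ := exists_block n e m u₁ hh 0
    (fun h => Sum.elim (fun t => if t = h.2 then 1 else 0)
      (Sum.elim (fun l => if l = h.1 then 1 else 0) 0)) (fun _ => -1)
    (Sum.elim 0 (Sum.elim 0 (Sum.elim (fun c h => if h = c then 1 else 0) 0)))
  -- The second block collects the marks of all positions and compares them with every
  -- possible sequence.
  obtain ⟨B₂, hB₂⟩ := exists_block n e m u₂ hh
    (Sum.elim 0 (Sum.elim 0 (Sum.elim (fun c => Sum.elim 0 (Sum.elim 0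
      (Sum.elim (fun c' => if c' = c then 1 else 0) 0))) 0)))
    (fun h => Sum.elim 0 (Sum.elim (fun l => if l = h.2 then 1 else 0)
      (Sum.elim (fun c => if c.2 = h.1 c.1 then 1 else 0) 0)))
    (fun _ => -(n + 1 : ℝ))
    (Sum.elim 0 (Sum.elim 0 (Sum.elim 0 (fun w h => if F h.1 h.2 = w then 1 else 0))))
  obtain ⟨T, hU, hT⟩ := exists_transformer_two_blocks hd
    (fun t : υ => Function.extend e (Sum.elim (fun t' => if t = t' then 1 else 0) 0) 0)
    (fun j : Fin n => Function.extend e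
      (Sum.elim 0 (Sum.elim (fun l => if j = l then 1 else 0) 0)) 0) B₁ B₂
    (fun w : ω => Function.extend e
      (Sum.elim 0 (Sum.elim 0 (Sum.elim 0 fun w' => if w' = w then 1 else 0))) 0)
  refine ⟨T, fun x => funext fun j => ?_⟩
  set X₀ : Matrix (Fin C.width) (Fin n) ℝ := Matrix.of fun i j =>
    Function.extend e (Sum.elim (fun t' => if x j = t' then 1 else 0) 0) 0 i +
    Function.extend e (Sum.elim (0 : υ → ℝ) (Sum.elim (fun l => if j = l then 1 else 0) 0)) 0 i
    with hX₀
  have hX₀e : ∀ a j, X₀ (e a) j =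
      Sum.elim (fun t' => if x j = t' then (1 : ℝ) else 0)
        (Sum.elim (fun l => if j = l then 1 else 0) 0) a := by
    intro a j
    rw [hX₀, Matrix.of_apply, e.injective.extend_apply, e.injective.extend_apply]
    rcases a with t | l | c | w <;> simp
  have h₁ : ∀ a j, B₁.apply X₀ (e a) j = Sum.elim (fun t' => if x j = t' then (1 : ℝ) else 0)
        (Sum.elim (fun l => if j = l then 1 else 0)
          (Sum.elim (fun c => if j = c.1 ∧ x j = c.2 then 1 else 0) 0)) a := by
    intro a j
    rw [hB₁ X₀ (Matrix.of fun a j => X₀ (e a) j) (by simp)]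
    simp only [Matrix.of_apply, hX₀e]
    rcases a with t | l | c | w
    · simp
    · simp
    · obtain ⟨k, t⟩ := c
      simp only [ι, Fintype.sum_sum_type]
      by_cases h2 : j = k
      · subst h2
        by_cases h1 : x j = t <;> simp [h1]
      · by_cases h1 : x j = t <;> simp [h1, h2]
    · simp
  let Y : Matrix ι (Fin n) ℝ := Matrix.of fun a j =>
    Sum.elim (fun t' => if x j = t' then (1 : ℝ) else 0)
        (Sum.elim (fun l => if j = l then 1 else 0)
          (Sum.elim (fun c => (if j = c.1 ∧ x j = c.2 then 1 else 0) +
            if x c.1 = c.2 then 1 else 0) 0)) a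
  have h₂ : ∀ w j, B₂.apply (B₁.apply X₀) (e (.inr (.inr (.inr w)))) j =
      if F x j = w then 1 else 0 := by
    intro w j
    rw [hB₂ (B₁.apply X₀) Y]
    · have hpre : ∀ h : (Fin n → υ) × Fin n, (∑ c : ι, (Sum.elim 0
          (Sum.elim (fun l => if l = h.2 then 1 else 0)
          (Sum.elim (fun c => if c.2 = h.1 c.1 then 1 else 0) 0)) : ι → ℝ) c * Y c j) =
          (∑ l, ((if j = l ∧ x j = h.1 l then (1 : ℝ) else 0) + if x l = h.1 l then 1 else 0)) +
            (if j = h.2 then 1 else 0) := by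
        intro h
        simp [ι, Y, Fintype.sum_sum_type, Fintype.sum_prod_type]
        rw [add_comm]
      simp only [hpre, relu_matches]
      simp [Y, Fintype.sum_prod_type, ite_and]
    · intro a j
      rw [h₁]
      simp only [h₁]
      rcases a with t | l | c | w
      · simp [Y]
      · simp [Y]
      · simp [ι, Y, Fintype.sum_sum_type]
        rw [Finset.sum_comm, Finset.sum_eq_single c]
        · simp [ite_and]
        · intro b _ hb
          simp [hb]
        · simp
      · simp [Y]
  have hlogit : ∀ w, T.logit x j w = if F x j = w then 1 else 0 := by
    intro w
    rw [Transformer.logit, hU, hT, ← h₂ w j]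
    rw [← Fintype.sum_of_injective e e.injective
      (fun a => (Sum.elim 0 (Sum.elim 0 (Sum.elim 0 fun w' => if w' = w then 1 else 0)) : ι → ℝ) a *
        B₂.apply (B₁.apply X₀) (e a) j)]
    · simp [ι, Fintype.sum_sum_type]
    · intro i hi
      simp only [Function.extend_apply' _ _ _ hi, Pi.zero_apply, zero_mul]
    · intro a
      simp only [e.injective.extend_apply, hX₀]
  refine T.output_eq_of_logit x j _ fun v hv => ?_
  simp [hlogit, hv.symm]

/-! ### What a prompt reveals about the state -/

/-- The natural number whose decimal digits are those of the numeral of `x` with precision `p`. -/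
noncomputable def numeralIndex (p : ℕ) (x : ℝ) : ℕ := min ⌊|x| * 10 ^ p⌋₊ (10 ^ (2 * p) - 1)

lemma numeralIndex_lt (p : ℕ) (x : ℝ) : numeralIndex p x < 10 ^ (2 * p) :=
  lt_of_le_of_lt (min_le_right _ _) (Nat.sub_lt (by positivity) one_pos)

lemma mod_pow_eq_of_digits_eq {k k' m : ℕ}
    (h : ∀ j < m, k / 10 ^ j % 10 = k' / 10 ^ j % 10) : k % 10 ^ m = k' % 10 ^ m := by
  induction m with
  | zero => simp [Nat.mod_one]
  | succ m ih =>
    rw [Nat.mod_pow_succ, Nat.mod_pow_succ, ih fun j hj => h j (by omega), h m (by omega)]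

@[simp]
lemma length_numeral (α : Type*) (p : ℕ) (x : ℝ) : (numeral α p x).length = 2 * p + 2 := by
  simp [numeral]
  omega

lemma numeral_eq_iff {α : Type*} {p : ℕ} {x y : ℝ} :
    numeral α p x = numeral α p y ↔
      (x < 0 ↔ y < 0) ∧ numeralIndex p x = numeralIndex p y := by
  constructor
  · intro h
    simp only [numeral, List.cons.injEq] at h
    obtain ⟨hs, h⟩ := h
    refine ⟨by split_ifs at hs <;> simp_all [not_lt.2], ?_⟩
    obtain ⟨h₁, h₂⟩ := List.append_inj h (by simp)
    simp only [List.cons.injEq, true_and] at h₂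
    rw [← Nat.mod_eq_of_lt (numeralIndex_lt p x), ← Nat.mod_eq_of_lt (numeralIndex_lt p y)]
    refine mod_pow_eq_of_digits_eq fun j hj => ?_
    simp only [List.map_inj_left, List.mem_range, digitAt, Token.digit.injEq, Fin.mk.injEq]
      at h₁ h₂
    rcases lt_or_ge j p with hjp | hjp
    · have := h₂ (p - 1 - j) (by omega)
      rwa [show p - 1 - (p - 1 - j) = j by omega] at this
    · have := h₁ (2 * p - 1 - j) (by omega)
      rwa [show 2 * p - 1 - (2 * p - 1 - j) = j by omega] at this
  · rintro ⟨hs, h⟩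
    simp only [numeralIndex] at h
    simp only [numeral, hs, h]

/-- A numeral of lower precision is determined by one of higher precision. -/
lemma numeralIndex_coarsen {q p : ℕ} (hqp : q ≤ p) (x : ℝ) :
    numeralIndex q x = min (numeralIndex p x / 10 ^ (p - q)) (10 ^ (2 * q) - 1) := by
  obtain ⟨d, rfl⟩ := Nat.exists_eq_add_of_le hqp
  have hfloor : ⌊|x| * 10 ^ q⌋₊ = ⌊|x| * 10 ^ (q + d)⌋₊ / 10 ^ d := by
    rw [← Nat.floor_div_natCast]
    congr 1
    push_cast
    field_simp
    ring
  have hcap : 10 ^ (2 * q) - 1 ≤ (10 ^ (2 * (q + d)) - 1) / 10 ^ d := by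
    rw [Nat.le_div_iff_mul_le (by positivity)]
    have h1 : (10 : ℕ) ^ (2 * (q + d)) = 10 ^ (2 * q) * 10 ^ d * 10 ^ d := by ring
    have h2 : 1 ≤ 10 ^ d := Nat.one_le_pow _ _ (by norm_num)
    have h3 : 10 ^ (2 * q) * 10 ^ d ≤ 10 ^ (2 * q) * 10 ^ d * 10 ^ d :=
      Nat.le_mul_of_pos_right _ h2
    rw [h1, Nat.sub_mul]
    omega
  rw [Nat.add_sub_cancel_left, numeralIndex, numeralIndex, hfloor]
  rcases le_total ⌊|x| * 10 ^ (q + d)⌋₊ (10 ^ (2 * (q + d)) - 1) with h | h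
  · rw [min_eq_left h]
  · rw [min_eq_right h, min_eq_right hcap,
      min_eq_right (hcap.trans (Nat.div_le_div_right h))]

lemma numeral_eq_of_le {α : Type*} {q p : ℕ} (hqp : q ≤ p) {x y : ℝ}
    (h : numeral α p x = numeral α p y) : numeral α q x = numeral α q y := by
  rw [numeral_eq_iff] at h ⊢
  rw [numeralIndex_coarsen hqp, numeralIndex_coarsen hqp, h.2]
  exact ⟨h.1, rfl⟩

/-- Numbers below the cap that have the same numeral differ by at most a unit of the last
place. -/
lemma abs_sub_le_of_numeral_eq {α : Type*} {p : ℕ} {x y R : ℝ} (hx : |x| ≤ R) (hy : |y| ≤ R)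
    (hR : R < 10 ^ p) (h : numeral α p x = numeral α p y) : |x - y| ≤ (1 / 10) ^ p := by
  obtain ⟨hs, hk⟩ := numeral_eq_iff.1 h
  have hp : (0 : ℝ) < 10 ^ p := by positivity
  have huncapped : ∀ z : ℝ, |z| ≤ R → numeralIndex p z = ⌊|z| * 10 ^ p⌋₊ := by
    intro z hz
    refine min_eq_left (Nat.le_sub_one_of_lt ?_)
    rw [Nat.floor_lt (by positivity)]
    push_cast
    rw [two_mul, pow_add]
    exact mul_lt_mul_of_pos_right (hz.trans_lt hR) hp
  rw [huncapped x hx, huncapped y hy] at hk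
  have h1 := Nat.floor_le (show 0 ≤ |x| * 10 ^ p by positivity)
  have h2 := Nat.floor_le (show 0 ≤ |y| * 10 ^ p by positivity)
  have h3 := Nat.lt_floor_add_one (|x| * 10 ^ p)
  have h4 := Nat.lt_floor_add_one (|y| * 10 ^ p)
  rw [hk] at h1 h3
  have hsub : |x - y| = |(|x| - |y|)| := by
    by_cases hx0 : x < 0
    · rw [abs_of_neg hx0, abs_of_neg (hs.1 hx0), abs_sub_comm]
      ring_nf
    · rw [abs_of_nonneg (not_lt.1 hx0), abs_of_nonneg (not_lt.1 (fun h => hx0 (hs.2 h)))]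
  rw [hsub, one_div, inv_pow, inv_eq_one_div, abs_le, neg_le, le_div_iff₀ hp, le_div_iff₀ hp]
  constructor <;> nlinarith

lemma append_eq_append_iff_of_length_eq {δ : Type*} {a b c d : List δ} (h : a.length = c.length) :
    a ++ b = c ++ d ↔ a = c ∧ b = d :=
  ⟨fun H => List.append_inj H h, by rintro ⟨rfl, rfl⟩; rfl⟩

lemma flatMap_finRange_eq_iff {δ : Type*} {n : ℕ} {f g : Fin n → List δ}
    (h : ∀ k, (f k).length = (g k).length) :
    (List.finRange n).flatMap f = (List.finRange n).flatMap g ↔ ∀ k, f k = g k := by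
  suffices H : ∀ l : List (Fin n), l.flatMap f = l.flatMap g ↔ ∀ k ∈ l, f k = g k by
    simpa using H (List.finRange n)
  intro l
  induction l with
  | nil => simp
  | cons k l ih =>
    rw [List.flatMap_cons, List.flatMap_cons, append_eq_append_iff_of_length_eq (h k), ih]
    simp

lemma tagged_eq_iff {α : Type*} {t : Tag} {l l' : List (Token α)} :
    tagged t l = tagged t l' ↔ l = l' := by
  simp [tagged]

@[simp]
lemma length_tagged {α : Type*} (t : Tag) (l : List (Token α)) :
    (tagged t l).length = l.length + 2 := by
  simp [tagged]

lemma length_stateTokens_eq (α : Type*) {N : Dims} (p : ℕ) (s s' : State N) :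
    (stateTokens α p s).length = (stateTokens α p s').length := by
  simp [stateTokens, List.length_flatMap]

lemma stateTokens_eq_iff {α : Type*} {N : Dims} {p : ℕ} {s s' : State N} :
    stateTokens α p s = stateTokens α p s' ↔
      (∀ k a b, numeral α p (s.1 k a b).re = numeral α p (s'.1 k a b).re ∧
        numeral α p (s.1 k a b).im = numeral α p (s'.1 k a b).im) ∧
      (∀ k f, numeral α p (s.2.1 k f : ℝ) = numeral α p (s'.2.1 k f : ℝ)) ∧
      (∀ c, numeral α p (s.2.2.1.1 c) = numeral α p (s'.2.2.1.1 c)) ∧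
      s.2.2.1.2 = s'.2.2.1.2 ∧
      ∀ k, numeral α p (s.2.2.2 k) = numeral α p (s'.2.2.2 k) := by
  rw [stateTokens, stateTokens, tagged_eq_iff,
    append_eq_append_iff_of_length_eq (by simp [List.length_flatMap]),
    append_eq_append_iff_of_length_eq (by simp [List.length_flatMap]),
    append_eq_append_iff_of_length_eq (by simp [List.length_flatMap]),
    tagged_eq_iff, tagged_eq_iff, tagged_eq_iff, tagged_eq_iff,
    flatMap_finRange_eq_iff (by simp [List.length_flatMap]),
    flatMap_finRange_eq_iff (by simp [List.length_flatMap]),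
    append_eq_append_iff_of_length_eq (by simp [List.length_flatMap]),
    flatMap_finRange_eq_iff (by simp), flatMap_finRange_eq_iff (by simp)]
  have h1 : ∀ k, ((List.finRange N.rx).flatMap (fun a => (List.finRange N.tx).flatMap fun b =>
      numeral α p (s.1 k a b).re ++ numeral α p (s.1 k a b).im) =
      (List.finRange N.rx).flatMap (fun a => (List.finRange N.tx).flatMap fun b =>
      numeral α p (s'.1 k a b).re ++ numeral α p (s'.1 k a b).im)) ↔
      ∀ a b, numeral α p (s.1 k a b).re = numeral α p (s'.1 k a b).re ∧
        numeral α p (s.1 k a b).im = numeral α p (s'.1 k a b).im := by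
    intro k
    rw [flatMap_finRange_eq_iff (by simp [List.length_flatMap])]
    refine forall_congr' fun a => ?_
    rw [flatMap_finRange_eq_iff (by simp)]
    refine forall_congr' fun b => ?_
    rw [append_eq_append_iff_of_length_eq (by simp)]
  have h2 : ∀ k, ((List.finRange N.flows).flatMap (fun f => numeral α p (s.2.1 k f : ℝ)) =
      (List.finRange N.flows).flatMap fun f => numeral α p (s'.2.1 k f : ℝ)) ↔
      ∀ f, numeral α p (s.2.1 k f : ℝ) = numeral α p (s'.2.1 k f : ℝ) := fun k =>
    flatMap_finRange_eq_iff (by simp)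
  simp only [h1, h2, List.map_inj_left, List.mem_finRange, true_imp_iff, Token.bit.injEq,
    funext_iff, and_assoc]

lemma prompt_eq_iff {α : Type*} {N : Dims} {p : ℕ} {x y : Intent α × State N} :
    prompt p x = prompt p y ↔ stateTokens α p x.2 = stateTokens α p y.2 ∧ x.1 = y.1 := by
  rw [prompt, prompt, append_eq_append_iff_of_length_eq (length_stateTokens_eq α p _ _),
    tagged_eq_iff, (List.map_injective_iff.2 fun a b h => by simpa using h).eq_iff]
  obtain ⟨⟨t⟩, s⟩ := x
  obtain ⟨⟨t'⟩, s'⟩ := y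
  simp

/-- A prompt of higher precision determines the prompt of lower precision. -/
lemma prompt_eq_of_le {α : Type*} {N : Dims} {q p : ℕ} (hqp : q ≤ p) {x y : Intent α × State N}
    (h : prompt p x = prompt p y) : prompt q x = prompt q y := by
  rw [prompt_eq_iff, stateTokens_eq_iff] at h ⊢
  obtain ⟨⟨h1, h2, h3, h4, h5⟩, h6⟩ := h
  exact ⟨⟨fun k a b => ⟨numeral_eq_of_le hqp (h1 k a b).1, numeral_eq_of_le hqp (h1 k a b).2⟩,
    fun k f => numeral_eq_of_le hqp (h2 k f), fun c => numeral_eq_of_le hqp (h3 c), h4,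
    fun k => numeral_eq_of_le hqp (h5 k)⟩, h6⟩

lemma pad_notMem_numeral (α : Type*) (p : ℕ) (x : ℝ) : Token.pad ∉ numeral α p x := by
  simp only [numeral, digitAt]
  split_ifs <;> simp

lemma pad_notMem_prompt {α : Type*} {N : Dims} (p : ℕ) (x : Intent α × State N) :
    Token.pad ∉ prompt p x := by
  simp [prompt, stateTokens, tagged, pad_notMem_numeral]

/-- A prompt that fits into the context window can be recovered from the padded context. -/
lemma prompt_eq_of_context_eq {α : Type*} {N : Dims} {p n : ℕ} {x y : Intent α × State N}
    (hx : (prompt p x).length ≤ n) (hy : (prompt p y).length ≤ n)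
    (h : context p n x = context p n y) : prompt p x = prompt p y := by
  have hget : ∀ j, (prompt p x).getD j Token.pad = (prompt p y).getD j Token.pad := by
    intro j
    rcases lt_or_ge j n with hj | hj
    · exact congrFun h ⟨j, hj⟩
    · rw [List.getD_eq_default _ _ (hx.trans hj), List.getD_eq_default _ _ (hy.trans hj)]
  have hlen : ∀ z w : Intent α × State N,
      (∀ j, (prompt p z).getD j Token.pad = (prompt p w).getD j Token.pad) →
      (prompt p z).length ≤ (prompt p w).length := by
    intro z w hzw
    by_contra! hlt
    have := hzw (prompt p w).length
    rw [List.getD_eq_default _ _ le_rfl, List.getD_eq_getElem _ _ hlt] at this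
    exact pad_notMem_prompt p z (this ▸ List.getElem_mem hlt)
  refine List.ext_getElem (le_antisymm (hlen x y hget) (hlen y x fun j => (hget j).symm))
    fun j h₁ h₂ => ?_
  rw [← List.getD_eq_getElem _ Token.pad h₁, ← List.getD_eq_getElem _ Token.pad h₂, hget]

/-- The prompts of bounded intents have bounded length. -/
lemma exists_length_prompt_le (α : Type*) (N : Dims) (p l : ℕ) :
    ∃ n, ∀ x : Intent α × State N, x.1.text.length ≤ l → (prompt p x).length ≤ n := by
  let s₀ : State N := (0, 0, (0, fun _ => false), 0)
  refine ⟨(stateTokens α p s₀).length + (l + 2), fun x hx => ?_⟩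
  rw [prompt, List.length_append, length_stateTokens_eq α p x.2 s₀, length_tagged, List.length_map]
  omega

/-! ### Attainable policies -/

lemma reduceOption_map_some {β : Type*} (w : List β) : (w.map some).reduceOption = w := by
  induction w with
  | nil => rfl
  | cons b w ih => rw [List.map_cons, List.reduceOption_cons_of_some, ih]

lemma decode_getElem? {β : Type*} {n : ℕ} (w : List β) (hw : w.length ≤ n) :
    decode (fun j : Fin n => w[(j : ℕ)]?) = w := by
  have h : List.ofFn (fun j : Fin n => w[(j : ℕ)]?) =
      w.map some ++ List.replicate (n - w.length) none := by
    refine List.ext_getElem (by simp; omega) fun j h₁ h₂ => ?_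
    rw [List.getElem_ofFn]
    rcases lt_or_ge j w.length with hj | hj
    · simp [hj]
    · simp [hj.not_gt, hj]
  rw [decode, h, List.takeWhile_append_of_pos (by simp)]
  have : (List.replicate (n - w.length) (none : Option β)).takeWhile Option.isSome = [] := by
    cases n - w.length <;> simp [List.replicate_succ]
  rw [this, List.append_nil, reduceOption_map_some]

lemma filterAction_val {β : Type*} {Lg : Finset (List β)} {V : Lg → Bool}
    (fallback a : Action Lg V) : filterAction Lg V fallback a.1.1 = a := by
  obtain ⟨⟨c, hc⟩, hV⟩ := a
  exact dif_pos ⟨hc, hV⟩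

instance finite_action {β : Type*} (Lg : Finset (List β)) (V : Lg → Bool) :
    Finite (Action Lg V) :=
  inferInstanceAs (Finite {c : Lg // V c = true})

instance finite_token (α : Type*) [Finite α] : Finite (Token α) := by
  let g : (Tag ⊕ Tag) ⊕ (Fin 3 ⊕ Fin 10) ⊕ Bool ⊕ α ⊕ Unit → Token α :=
    Sum.elim (Sum.elim .opening .closing) (Sum.elim
      (Sum.elim (fun i => if i = 0 then .plus else if i = 1 then .minus else .point) .digit)
      (Sum.elim .bit (Sum.elim .symbol fun _ => .pad)))
  have : Finite Tag := Finite.of_surjective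
    (fun i : Fin 6 => ![Tag.state, .csi, .queues, .config, .sinr, .intent] i) fun t => by
      cases t
      exacts [⟨0, rfl⟩, ⟨1, rfl⟩, ⟨2, rfl⟩, ⟨3, rfl⟩, ⟨4, rfl⟩, ⟨5, rfl⟩]
  refine Finite.of_surjective g fun t => ?_
  cases t with
  | opening t => exact ⟨.inl (.inl t), rfl⟩
  | closing t => exact ⟨.inl (.inr t), rfl⟩
  | plus => exact ⟨.inr (.inl (.inl 0)), rfl⟩
  | minus => exact ⟨.inr (.inl (.inl 1)), rfl⟩
  | point => exact ⟨.inr (.inl (.inl 2)), rfl⟩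
  | digit k => exact ⟨.inr (.inl (.inr k)), rfl⟩
  | bit b => exact ⟨.inr (.inr (.inl b)), rfl⟩
  | symbol a => exact ⟨.inr (.inr (.inr (.inl a))), rfl⟩
  | pad => exact ⟨.inr (.inr (.inr (.inr ()))), rfl⟩

/-- The policies that a transformer can realize on a bounded task are the functions of the
prompt. -/
lemma attainable_of_prompt_policies {α β : Type*} [Finite α] [Finite β] {N : Dims}
    {Lg : Finset (List β)} {V : Lg → Bool} (env : State N → Action Lg V → State N)
    (fallback : Action Lg V) {D : Set (Intent α × State N)} (hD : IsBoundedTask D)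
    {P : (Intent α × State N → Action Lg V × State N) → Prop}
    (h : ∃ p₀, ∀ p ≥ p₀, ∃ a : Intent α × State N → Action Lg V,
      (∀ x ∈ D, ∀ y ∈ D, prompt p x = prompt p y → a x = a y) ∧
      ∀ O : Intent α × State N → Action Lg V × State N,
        (∀ x ∈ D, O x = (a x, env x.2 (a x))) → P O) :
    Attainable env fallback P := by
  classical
  obtain ⟨l, R, hlR⟩ := hD
  obtain ⟨p₀, h⟩ := h
  refine ⟨p₀, fun p hp => ?_⟩
  obtain ⟨a, ha, haP⟩ := h p hp
  obtain ⟨n₁, hn₁⟩ := exists_length_prompt_le α N p l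
  refine ⟨max n₁ (Lg.sup List.length), fun n hn => ?_⟩
  have hn₁' : ∀ x ∈ D, (prompt p x).length ≤ n := fun x hx =>
    (hn₁ x (hlR x hx).1).trans ((le_max_left _ _).trans hn)
  have hlen : ∀ c : Action Lg V, c.1.1.length ≤ n := fun c =>
    (Finset.le_sup (f := List.length) c.1.2).trans ((le_max_right _ _).trans hn)
  -- The action is a function of the context alone.
  let A : (Fin n → Token α) → Action Lg V := fun c =>
    if hc : ∃ x ∈ D, context p n x = c then a hc.choose else fallback
  have hA : ∀ x ∈ D, A (context p n x) = a x := by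
    intro x hx
    have hc : ∃ y ∈ D, context p n y = context p n x := ⟨x, hx, rfl⟩
    simp only [A, dif_pos hc]
    obtain ⟨hy, hyx⟩ := hc.choose_spec
    exact ha _ hy _ hx (prompt_eq_of_context_eq (hn₁' _ hy) (hn₁' _ hx) hyx)
  obtain ⟨C₀, hC₀⟩ := exists_transformer_output_eq (υ := Token α) (ω := Option β) n
    fun c j => (A c).1.1[(j : ℕ)]?
  refine ⟨C₀, fun C hC => ?_⟩
  obtain ⟨T, hT⟩ := hC₀ C hC
  have hpol : ∀ x ∈ D, policy fallback p T x = a x := by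
    intro x hx
    rw [policy, hT, decode_getElem? _ (hlen _), filterAction_val, hA x hx]
  exact ⟨T, haP _ fun x hx => by rw [operator, hpol x hx]⟩

lemma Attainable.mono {α β : Type*} [Finite β] {N : Dims} {Lg : Finset (List β)} {V : Lg → Bool}
    {env : State N → Action Lg V → State N} {fallback : Action Lg V}
    {P Q : (Intent α × State N → Action Lg V × State N) → Prop} (h : ∀ O, P O → Q O)
    (hP : Attainable env fallback P) : Attainable env fallback Q := by
  obtain ⟨p₀, hp⟩ := hP
  refine ⟨p₀, fun p hpp => ?_⟩
  obtain ⟨n₀, hn⟩ := hp p hpp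
  refine ⟨n₀, fun n hnn => ?_⟩
  obtain ⟨C₀, hC⟩ := hn n hnn
  exact ⟨C₀, fun C hCC => (hC C hCC).imp fun T hT => h _ hT⟩

/-! ### Compact tasks -/

open Filter Topology

/-- The largest task with intents of length at most `l` and numerical entries at most `R`. -/
def boundedBox (α : Type*) (N : Dims) (l : ℕ) (R : ℝ) : Set (Intent α × State N) :=
  {x | x.1.text.length ≤ l ∧ State.BoundedBy R x.2}

lemma isCompact_boundedBox (α : Type*) [Finite α] (N : Dims) (l : ℕ) (R : ℝ) :
    IsCompact (boundedBox α N l R) := by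
  have hI : IsCompact {i : Intent α | i.text.length ≤ l} := by
    refine Set.Finite.isCompact (((List.finite_length_le α l).image Intent.mk).subset ?_)
    rintro ⟨t⟩ ht
    exact ⟨t, ht, rfl⟩
  have hq : IsCompact {t : ℝ≥0 | (t : ℝ) ≤ R} := by
    refine (isCompact_Icc (a := 0) (b := R.toNNReal)).of_isClosed_subset
      (isClosed_le NNReal.continuous_coe continuous_const) fun t ht => ⟨zero_le, ?_⟩
    exact NNReal.le_toNNReal_of_coe_le ht
  have hball : ∀ E : Type, ∀ [NormedAddCommGroup E] [ProperSpace E],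
      IsCompact (Metric.closedBall (0 : E) R) := fun E _ _ => isCompact_closedBall _ _
  have hK := hI.prod
    ((isCompact_univ_pi fun _ : Fin N.users => isCompact_univ_pi fun _ : Fin N.rx =>
        isCompact_univ_pi fun _ : Fin N.tx => hball ℂ).prod
      ((isCompact_univ_pi fun _ : Fin N.users => isCompact_univ_pi fun _ : Fin N.flows => hq).prod
        (((isCompact_univ_pi fun _ : Fin N.cells => hball ℝ).prod
          (isCompact_univ (X := Fin N.carriers → Bool))).prod
          (isCompact_univ_pi fun _ : Fin N.users => hball ℝ))))
  convert hK using 1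
  ext ⟨i, s⟩
  simp [boundedBox, State.BoundedBy, Set.mem_prod]

lemma IsBoundedTask.isCompact {α : Type*} [Finite α] {N : Dims} {D : Set (Intent α × State N)}
    (hD : IsBoundedTask D) (hc : IsClosed D) : IsCompact D := by
  obtain ⟨l, R, h⟩ := hD
  exact (isCompact_boundedBox α N l R).of_isClosed_subset hc fun x hx => h x hx

lemma tendsto_of_numeral_eq {α : Type*} {F : Filter ℕ} (hF : F ≤ atTop) {u v : ℕ → ℝ} {R c : ℝ}
    (hu : ∀ p, |u p| ≤ R) (hv : ∀ p, |v p| ≤ R)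
    (h : ∀ p, numeral α p (u p) = numeral α p (v p)) (hc : Tendsto u F (𝓝 c)) :
    Tendsto v F (𝓝 c) := by
  refine (tendsto_iff_of_dist ?_).1 hc
  refine squeeze_zero' (Eventually.of_forall fun p => dist_nonneg) ?_
    ((tendsto_pow_atTop_nhds_zero_of_lt_one (by norm_num : (0 : ℝ) ≤ 1 / 10)
      (by norm_num)).mono_left hF)
  filter_upwards [hF ((tendsto_pow_atTop_atTop_of_one_lt (by norm_num : (1 : ℝ) < 10)).eventually
    (eventually_gt_atTop R))] with p hp
  exact abs_sub_le_of_numeral_eq (hu p) (hv p) hp (h p)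

/-- Points of a bounded task that have the same prompt at ever higher precision have the same
limit. -/
lemma tendsto_of_prompt_eq {α : Type*} {N : Dims} {D : Set (Intent α × State N)}
    (hD : IsBoundedTask D) {F : Filter ℕ} (hF : F ≤ atTop) {x y : ℕ → Intent α × State N}
    (hx : ∀ p, x p ∈ D) (hy : ∀ p, y p ∈ D) (h : ∀ p, prompt p (x p) = prompt p (y p))
    {z : Intent α × State N} (hz : Tendsto x F (𝓝 z)) : Tendsto y F (𝓝 z) := by
  obtain ⟨l, R, hlR⟩ := hD
  have hb : ∀ p, State.BoundedBy R (x p).2 ∧ State.BoundedBy R (y p).2 :=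
    fun p => ⟨(hlR _ (hx p)).2, (hlR _ (hy p)).2⟩
  simp only [prompt_eq_iff, stateTokens_eq_iff] at h
  simp only [Prod.tendsto_iff, tendsto_pi_nhds] at hz ⊢
  obtain ⟨z1, z2, z3, ⟨z4, z5⟩, z6⟩ := hz
  refine ⟨?_, ?_, ?_, ⟨?_, ?_⟩, ?_⟩
  · simpa only [← (h _).2] using z1
  · intro k a b
    have hre : Tendsto (fun p => ((y p).2.1 k a b).re) F (𝓝 (z.2.1 k a b).re) :=
      tendsto_of_numeral_eq hF (fun p => (Complex.abs_re_le_norm _).trans ((hb p).1.1 k a b))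
        (fun p => (Complex.abs_re_le_norm _).trans ((hb p).2.1 k a b))
        (fun p => ((h p).1.1 k a b).1) ((Complex.continuous_re.tendsto _).comp (z2 k a b))
    have him : Tendsto (fun p => ((y p).2.1 k a b).im) F (𝓝 (z.2.1 k a b).im) :=
      tendsto_of_numeral_eq hF (fun p => (Complex.abs_im_le_norm _).trans ((hb p).1.1 k a b))
        (fun p => (Complex.abs_im_le_norm _).trans ((hb p).2.1 k a b))
        (fun p => ((h p).1.1 k a b).2) ((Complex.continuous_im.tendsto _).comp (z2 k a b))
    have hsum := ((Complex.continuous_ofReal.tendsto _).comp hre).add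
      (((Complex.continuous_ofReal.tendsto _).comp him).mul_const Complex.I)
    simpa only [Function.comp_def, Complex.re_add_im] using hsum
  · intro k f
    have habs : ∀ t : ℝ≥0, (t : ℝ) ≤ R → |(t : ℝ)| ≤ R := fun t ht => by
      rwa [abs_of_nonneg t.coe_nonneg]
    exact NNReal.tendsto_coe.1 (tendsto_of_numeral_eq hF
      (fun p => habs _ ((hb p).1.2.1 k f)) (fun p => habs _ ((hb p).2.2.1 k f))
      (fun p => (h p).1.2.1 k f) (NNReal.tendsto_coe.2 (z3 k f)))
  · intro c
    exact tendsto_of_numeral_eq hF (fun p => (hb p).1.2.2.1 c) (fun p => (hb p).2.2.2.1 c)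
      (fun p => (h p).1.2.2.1 c) (z4 c)
  · simpa only [← (h _).1.2.2.2.1] using z5
  · intro k
    exact tendsto_of_numeral_eq hF (fun p => (hb p).1.2.2.2 k) (fun p => (hb p).2.2.2.2 k)
      (fun p => (h p).1.2.2.2.2 k) (z6 k)

/-- A function that is continuous on a closed bounded task varies little between points with the
same prompt of sufficient precision. Closeness is measured by a neighbourhood `W` of the
diagonal, which covers both discrete and metric targets. -/
lemma exists_precision {α : Type*} [Finite α] {N : Dims} {D : Set (Intent α × State N)}
    (hD : IsBoundedTask D) (hc : IsClosed D) {Y : Type*} [TopologicalSpace Y]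
    {g : Intent α × State N → Y} (hg : ContinuousOn g D) {W : Set (Y × Y)}
    (hW : ∀ y, W ∈ 𝓝 (y, y)) :
    ∃ p₀, ∀ p ≥ p₀, ∀ x ∈ D, ∀ y ∈ D, prompt p x = prompt p y → (g x, g y) ∈ W := by
  by_contra! hcon
  have hcon' : ∀ p, ∃ x ∈ D, ∃ y ∈ D, prompt p x = prompt p y ∧ (g x, g y) ∉ W := by
    intro p
    obtain ⟨q, hq, x, hx, y, hy, hxy, hxyW⟩ := hcon p
    exact ⟨x, hx, y, hy, prompt_eq_of_le hq hxy, hxyW⟩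
  choose x hx y hy hxy hxyW using hcon'
  -- By compactness the points `x p` converge along an ultrafilter, and the `y p` with them.
  let U : Ultrafilter ℕ := Ultrafilter.of atTop
  have hU : (U : Filter ℕ) ≤ atTop := Ultrafilter.of_le _
  obtain ⟨z, hz, hxz⟩ := (hD.isCompact hc).ultrafilter_le_nhds (U.map x)
    (le_principal_iff.2 (mem_map.2 (univ_mem' hx)))
  have hxz' : Tendsto x U (𝓝 z) := hxz
  have hyz : Tendsto y U (𝓝 z) := tendsto_of_prompt_eq hD hU hx hy hxy hxz'
  have hgx : Tendsto (fun p => g (x p)) U (𝓝 (g z)) :=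
    (hg z hz).tendsto.comp (tendsto_nhdsWithin_iff.2 ⟨hxz', Eventually.of_forall hx⟩)
  have hgy : Tendsto (fun p => g (y p)) U (𝓝 (g z)) :=
    (hg z hz).tendsto.comp (tendsto_nhdsWithin_iff.2 ⟨hyz, Eventually.of_forall hy⟩)
  have hev : ∀ᶠ p in (U : Filter ℕ), (g (x p), g (y p)) ∈ W :=
    (hgx.prodMk_nhds hgy) (hW (g z))
  obtain ⟨p, hp⟩ := hev.exists
  exact hxyW p hp

lemma attainable_of_continuousOn {α β : Type*} [Finite α] [Finite β] {N : Dims}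
    {Lg : Finset (List β)} {V : Lg → Bool} (env : State N → Action Lg V → State N)
    (fallback : Action Lg V) {D : Set (Intent α × State N)} (hD : IsBoundedTask D)
    (hc : IsClosed D) {f : Intent α × State N → Action Lg V} (hf : ContinuousOn f D) :
    Attainable env fallback fun O => ∀ x ∈ D, O x = (f x, env x.2 (f x)) := by
  obtain ⟨p₀, hp₀⟩ := exists_precision hD hc hf (W := Set.diagonal _) fun a =>
    (isOpen_discrete _).mem_nhds rfl
  exact attainable_of_prompt_policies env fallback hD
    ⟨p₀, fun p hp => ⟨f, fun x hx y hy hxy => hp₀ p hp x hx y hy hxy, fun O hO => hO⟩⟩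

/-! ### Approximation -/

/-- Lusin's theorem for a function with finitely many values: it is continuous on a
closed set that carries all but `ε` of the measure. -/
lemma exists_isClosed_continuousOn {Ω A : Type*} [TopologicalSpace Ω] [MeasurableSpace Ω]
    [TopologicalSpace A] [DiscreteTopology A] [Finite A] [MeasurableSpace A]
    [MeasurableSingletonClass A]
    (μ : MeasureTheory.Measure Ω) [MeasureTheory.IsFiniteMeasure μ] [OpensMeasurableSpace Ω]
    [μ.WeaklyRegular] {f : Ω → A} (hf : Measurable f) {ε : ℝ≥0∞} (hε : 0 < ε) :
    ∃ K : Set Ω, IsClosed K ∧ ContinuousOn f K ∧ μ Kᶜ ≤ ε := by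
  have := Fintype.ofFinite A
  have hδ : ε / Fintype.card A ≠ 0 := (ENNReal.div_pos hε.ne' (ENNReal.natCast_ne_top _)).ne'
  choose K hKf hKc hKμ using fun a : A =>
    (hf (measurableSet_singleton a)).exists_isClosed_sdiff_lt
      (MeasureTheory.measure_ne_top μ _) hδ
  refine ⟨⋃ a, K a, isClosed_iUnion_of_finite hKc, ?_, ?_⟩
  · refine continuousOn_iff_isClosed.2 fun t _ =>
      ⟨⋃ a ∈ t, K a, t.toFinite.isClosed_biUnion fun a _ => hKc a, ?_⟩
    ext x
    simp only [Set.mem_inter_iff, Set.mem_preimage, Set.mem_iUnion, exists_prop]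
    refine and_congr_left fun ⟨b, hb⟩ => ⟨fun h => ⟨f x, h, ?_⟩, fun ⟨a, ha, hxa⟩ => ?_⟩
    · rwa [show f x = b from hKf b hb]
    · rwa [show f x = a from hKf a hxa]
  · calc μ (⋃ a, K a)ᶜ ≤ μ (⋃ a, f ⁻¹' {a} \ K a) :=
          MeasureTheory.measure_mono fun x hx => by
            simp only [Set.mem_compl_iff, Set.mem_iUnion, not_exists] at hx
            exact Set.mem_iUnion.2 ⟨f x, rfl, hx _⟩
      _ ≤ ∑ a, μ (f ⁻¹' {a} \ K a) := MeasureTheory.measure_iUnion_fintype_le _ _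
      _ ≤ ∑ _a : A, ε / Fintype.card A := Finset.sum_le_sum fun a _ => (hKμ a).le
      _ ≤ ε := by
          rw [Finset.sum_const, Finset.card_univ, nsmul_eq_mul]
          exact ENNReal.mul_div_le

lemma attainable_of_measurable {α β : Type*} [Finite α] [Finite β] {N : Dims}
    {Lg : Finset (List β)} {V : Lg → Bool} (env : State N → Action Lg V → State N)
    (fallback : Action Lg V) {D : Set (Intent α × State N)} (hD : IsBoundedTask D)
    {f : Intent α × State N → Action Lg V} (hf : Measurable f)
    (μ : MeasureTheory.Measure (Intent α × State N)) [MeasureTheory.IsFiniteMeasure μ]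
    {ε : ℝ≥0∞} (hε : 0 < ε) :
    Attainable env fallback fun O => μ {x ∈ D | O x ≠ (f x, env x.2 (f x))} ≤ ε := by
  have : Countable (Intent α) :=
    Function.Injective.countable (f := Intent.text) fun ⟨s⟩ ⟨t⟩ h => congrArg _ h
  have : DiscreteMeasurableSpace (Intent α) := ⟨fun _ => trivial⟩
  have : DiscreteMeasurableSpace (Action Lg V) := ⟨fun _ => trivial⟩
  have : BorelSpace (Fin N.users → Fin N.rx → Fin N.tx → ℂ) := inferInstance
  have : BorelSpace (State N) := inferInstance
  have : BorelSpace (Intent α × State N) := inferInstance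
  obtain ⟨l, R, hlR⟩ := hD
  obtain ⟨K, hKc, hKf, hKμ⟩ := exists_isClosed_continuousOn μ hf hε
  refine Attainable.mono (fun O hO => ?_) (attainable_of_continuousOn env fallback
    (D := K ∩ boundedBox α N l R) ⟨l, R, fun x hx => hx.2⟩
    (hKc.inter (isCompact_boundedBox α N l R).isClosed) (hKf.mono Set.inter_subset_left))
  refine (MeasureTheory.measure_mono fun x hx => ?_).trans hKμ
  exact fun hxK => hx.2 (hO x ⟨hxK, hlR x hx.1⟩)

lemma attainable_of_continuousOn_effect {α β : Type*} [Finite α] [Finite β] {N : Dims}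
    {Lg : Finset (List β)} {V : Lg → Bool} (env : State N → Action Lg V → State N)
    (fallback : Action Lg V) {D : Set (Intent α × State N)} (hD : IsBoundedTask D)
    (hc : IsClosed D) {X : Type*} [PseudoMetricSpace X] (effect : Action Lg V → X)
    {g : Intent α × State N → X} (hg : ContinuousOn g D) {ε : ℝ} (hε : 0 < ε) :
    Attainable env fallback fun O => ∀ x ∈ D, dist (effect (O x).1) (g x) ≤
      Metric.infDist (g x) (Set.range effect) + ε := by
  classical
  obtain ⟨p₀, hp₀⟩ := exists_precision hD hc hg (W := {w | dist w.1 w.2 < ε / 2}) fun y =>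
    (isOpen_lt continuous_dist continuous_const).mem_nhds (by simp [hε])
  have : Nonempty (Action Lg V) := ⟨fallback⟩
  have hbest : ∀ z : X, ∃ a, dist (effect a) z ≤ Metric.infDist z (Set.range effect) := by
    intro z
    obtain ⟨_, ⟨a, rfl⟩, ha⟩ := (Set.finite_range effect).isCompact.exists_infDist_eq_dist
      (Set.range_nonempty effect) z
    exact ⟨a, by rw [ha, dist_comm]⟩
  choose best hbest using hbest
  refine attainable_of_prompt_policies env fallback hD ⟨p₀, fun p hp => ?_⟩
  have : Nonempty (Intent α × State N) := ⟨⟨[]⟩, 0, 0, (0, fun _ => false), 0⟩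
  -- The chosen action is best for one representative of all points with the same prompt.
  refine ⟨fun x => best (g (Function.invFunOn (prompt p) D (prompt p x))),
    fun x hx y hy hxy => by simp only [hxy], fun O hO x hx => ?_⟩
  have hex : ∃ y ∈ D, prompt p y = prompt p x := ⟨x, hx, rfl⟩
  rw [hO x hx]
  have hr := Function.invFunOn_mem hex
  have hrx := Function.invFunOn_eq hex
  set r := Function.invFunOn (prompt p) D (prompt p x)
  have hclose : dist (g r) (g x) < ε / 2 := hp₀ p hp r hr x hx hrx
  have h1 := dist_triangle (effect (best (g r))) (g r) (g x)
  have h2 := hbest (g r)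
  have h3 := Metric.infDist_le_infDist_add_dist (s := Set.range effect) (x := g r) (y := g x)
  simp only
  linarith

end LLMRAN

theorem proposition3p1 {α β : Type*} [Finite α] [Finite β] (N : LLMRAN.Dims)
    (Lg : Finset (List β)) (V : Lg → Bool)
    (env : LLMRAN.State N → LLMRAN.Action Lg V → LLMRAN.State N)
    (fallback : LLMRAN.Action Lg V)
    (D : Set (LLMRAN.Intent α × LLMRAN.State N)) (hD : LLMRAN.IsBoundedTask D) :
    -- a policy that reads the state through numerals of some precision is reproduced exactly
    (∀ (q : ℕ) (f : LLMRAN.Intent α × LLMRAN.State N → LLMRAN.Action Lg V),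
      (∀ x ∈ D, ∀ y ∈ D, LLMRAN.prompt q x = LLMRAN.prompt q y → f x = f y) →
      LLMRAN.Attainable env fallback fun O => ∀ x ∈ D, O x = (f x, env x.2 (f x))) ∧
    -- a policy that is continuous on a closed bounded task is reproduced exactly on it
    (IsClosed D → ∀ f : LLMRAN.Intent α × LLMRAN.State N → LLMRAN.Action Lg V,
      ContinuousOn f D →
      LLMRAN.Attainable env fallback fun O => ∀ x ∈ D, O x = (f x, env x.2 (f x))) ∧
    -- a measurable policy is approximated in measure
    (∀ f : LLMRAN.Intent α × LLMRAN.State N → LLMRAN.Action Lg V, Measurable f →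
      ∀ (μ : MeasureTheory.Measure (LLMRAN.Intent α × LLMRAN.State N))
        [MeasureTheory.IsFiniteMeasure μ] (ε : ENNReal), 0 < ε →
      LLMRAN.Attainable env fallback fun O =>
        μ {x ∈ D | O x ≠ (f x, env x.2 (f x))} ≤ ε) ∧
    -- a continuous target configuration is approximated uniformly, up to the resolution of
    -- the command language
    (IsClosed D → ∀ (X : Type*) [PseudoMetricSpace X] (effect : LLMRAN.Action Lg V → X)
        (g : LLMRAN.Intent α × LLMRAN.State N → X), ContinuousOn g D → ∀ ε : ℝ, 0 < ε →
      LLMRAN.Attainable env fallback fun O =>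
        ∀ x ∈ D, dist (effect (O x).1) (g x) ≤
          Metric.infDist (g x) (Set.range effect) + ε) := by
  refine ⟨fun q f hf => ?_, fun hc f hf => ?_, fun f hf μ _ ε hε => ?_,
    fun hc X _ effect g hg ε hε => ?_⟩
  · exact LLMRAN.attainable_of_prompt_policies env fallback hD ⟨q, fun p hp => ⟨f,
      fun x hx y hy hxy => hf x hx y hy (LLMRAN.prompt_eq_of_le hp hxy), fun O hO => hO⟩⟩
  · exact LLMRAN.attainable_of_continuousOn env fallback hD hc hf
  · exact LLMRAN.attainable_of_measurable env fallback hD hf μ hε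
  · exact LLMRAN.attainable_of_continuousOn_effect env fallback hD hc effect hg hε
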